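/- Let $s>1$, let $n$ be a positive divisor of $2^s-1$, and let $\beta\in\mathbb F_{2^s}$ be a primitive $n$-th root of unity. Write $\mathbb Z_n=\mathbb Z/n\mathbb Z$ with representatives $1,\dots,n$. For $I\subset\mathbb Z_n$ put $-I=\{n-i: i\in I\}$ and $$C(I)=\{(f(1),f(\beta),\dots,f(\beta^{n-1})) : f\in\langle x^m : m\in -I\rangle_{\mathbb F_{2^s}}\}\cap\mathbb F_2^n .$$ Call $I$ a cyclotomic coset if $I=2\cdot I$; for such $I$, $C(I)$ is a binary cyclic code of length $n$. The amplitude $\operatorname{Amp}(I)$ of a nonempty $I\subset\mathbb Z_n$ is the least $a$ such that $I\subset\{c,c+1,\dots,c+a-1\}$ for some $c\in\mathbb Z_n$. A pair $(C_1,C_2)$ of binary linear codes of length $n$ is a CSS-T pair if $C_2\subset C_1$, all words of $C_2$ have even Hamming weight, and for every $x\in C_2$ the shortening of $C_1^\perp$ in the set of zero coordinates of $x$ contains a self-dual code. The CSS quantum code of $C_2\subset C_1$ is the subspace of $(\mathbb C^2)^{\otimes n}$ spanned by the states $\sum_{c\in C_2}|x+c\rangle$, $x\in C_1$. Let $I_1,I_2\subset\mathbb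 Z_n$ be cyclotomic cosets (either may be empty) and let $J_2=\mathbb Z_n\setminus I_2$. Then $(C(I_1),C(I_2))$ is a CSS-T pair if and only if 1. $I_2\subset I_1$, and 2. $n\notin I_1+I_1+I_2$ (Minkowski sum in $\mathbb Z_n$). In this case the CSS quantum code of $(C(I_1),C(I_2))$ has parameters $[[n,\,|I_1|-|I_2|,\,\ge n-\operatorname{Amp}(J_2)+1]]$: its dimension is $2^{|I_1|-|I_2|}$, it corrects the erasure of any set of at most $n-\operatorname{Amp}(J_2)$ qubits (the encoded state is recovered by a quantum channel from the remaining qubits), and $$\min\{\operatorname{wt}(C(I_1)\setminus C(I_2)),\ \operatorname{wt}(C(I_2)^\perp\setminus C(I_1)^\perp)\}\ \ge\ n-\operatorname{Amp}(J_2)+1,$$ where $\operatorname{wt}(A)$ is the least Hamming weight of an element of $A$ and the minimum is $\infty$ if both sets are empty. -/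

import Mathlib

open scoped Pointwise ComplexOrder

noncomputable section

namespace CSST

/-! Binary linear codes -/

/-- A binary linear code with coordinates indexed by `ι`. -/
abbrev BinaryCode (ι : Type*) := Submodule (ZMod 2) (ι → ZMod 2)

/-- The dual code with respect to the Euclidean inner product. -/
def dual {ι : Type*} [Fintype ι] (C : BinaryCode ι) : BinaryCode ι where
  carrier := {y | ∀ x ∈ C, x ⬝ᵥ y = 0}
  add_mem' := by
    intro a b ha hb x hx
    rw [dotProduct_add, ha x hx, hb x hx, add_zero]
  zero_mem' := by
    intro x _
    exact dotProduct_zero x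
  smul_mem' := by
    intro r a ha x hx
    rw [dotProduct_smul, ha x hx, smul_zero]

/-- The code `C` is equal to its dual. -/
def IsSelfDual {ι : Type*} [Fintype ι] (C : BinaryCode ι) : Prop := dual C = C

/-- All codewords have even Hamming weight. -/
def IsEven {ι : Type*} [Fintype ι] (C : BinaryCode ι) : Prop :=
  ∀ c ∈ C, Even (hammingNorm c)

/-- The shortening of `C` in the set of coordinates `S`: all words indexed by the complement of
`S` which, extended by zero on `S`, lie in `C`. -/
def shortening {ι : Type*} (C : BinaryCode ι) (S : Finset ι) : BinaryCode {i // i ∉ S} :=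
  C.comap (Function.ExtendByZero.linearMap (ZMod 2) (Subtype.val : {i // i ∉ S} → ι))

/-- The set of positions of the zero coordinates of `x`. -/
def zeroSet {ι : Type*} [Fintype ι] (x : ι → ZMod 2) : Finset ι :=
  Finset.univ.filter fun i => x i = 0

/-- `(C₁, C₂)` is a CSS-T pair: `C₂ ⊆ C₁`, the code `C₂` is even, and for every `x ∈ C₂` the
shortening of the dual of `C₁` in the zero positions of `x` contains a self-dual code. -/
structure IsCSSTPair {ι : Type*} [Fintype ι] [DecidableEq ι] (C₁ C₂ : BinaryCode ι) : Prop where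
  le : C₂ ≤ C₁
  even : IsEven C₂
  selfDual : ∀ x ∈ C₂, ∃ D : BinaryCode {i // i ∉ zeroSet x},
    IsSelfDual D ∧ D ≤ shortening (dual C₁) (zeroSet x)

/-! Cyclic codes as subfield subcodes of evaluation codes -/

/-- A subset of `ℤ/n` that is equal to its image under multiplication by `2`. -/
def IsCyclotomicCoset {n : ℕ} (I : Finset (ZMod n)) : Prop :=
  I = I.image fun i => 2 * i

/-- The evaluation `f ↦ (f(1), f(β), …, f(β ^ (n - 1)))`. -/
def ev {F : Type*} [Field F] (n : ℕ) (β : F) : Polynomial F →ₗ[F] (Fin n → F) :=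
  LinearMap.pi fun j => Polynomial.leval (β ^ (j : ℕ))

/-- The evaluation code `B(M)`: the evaluations of the polynomials spanned by the monomials
`x ^ m` with `m ∈ M`. -/
def evalCode {F : Type*} [Field F] (n : ℕ) (β : F) (M : Finset ℕ) : Submodule F (Fin n → F) :=
  (Submodule.span F {f : Polynomial F | ∃ m ∈ M, f = Polynomial.X ^ m}).map (ev n β)

/-- The representatives in `{0, …, n - 1}` of the classes in `-I`. -/
def negExponents {n : ℕ} (I : Finset (ZMod n)) : Finset ℕ :=
  I.image fun i => (-i).val

/-- The binary code `C(I) = B(-I) ∩ 𝔽₂ⁿ`. -/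
def cyclicCode {F : Type*} [Field F] [Algebra (ZMod 2) F] {n : ℕ} (β : F)
    (I : Finset (ZMod n)) : BinaryCode (Fin n) :=
  ((evalCode n β (negExponents I)).restrictScalars (ZMod 2)).comap
    ((Algebra.linearMap (ZMod 2) F).compLeft (Fin n))

/-- The amplitude of `I`: the least `a` such that `I ⊆ {c, c + 1, …, c + a - 1}` for some
`c ∈ ℤ/n`. -/
def amplitude {n : ℕ} (I : Finset (ZMod n)) : ℕ :=
  sInf {a : ℕ | ∃ c : ZMod n, ∀ i ∈ I, ∃ t : ℕ, t < a ∧ i = c + (t : ZMod n)}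

/-! Quantum codes. The state space of a family of qubits indexed by `ι` is the space of functions
`(ι → ZMod 2) → ℂ`, whose standard basis is indexed by the bit strings. -/

/-- A quantum code: a subspace of the state space. -/
abbrev QuantumCode (ι : Type*) := Submodule ℂ ((ι → ZMod 2) → ℂ)

/-- The partial trace over the qubits in `S`. -/
def partialTrace {ι : Type*} [DecidableEq ι] (S : Finset ι)
    (ρ : Matrix (ι → ZMod 2) (ι → ZMod 2) ℂ) :
    Matrix ({i // i ∉ S} → ZMod 2) ({i // i ∉ S} → ZMod 2) ℂ :=
  fun u v => ∑ w : {i // i ∈ S} → ZMod 2,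
    ρ ((Equiv.piEquivPiSubtypeProd (· ∈ S) fun _ => ZMod 2).symm (w, u))
      ((Equiv.piEquivPiSubtypeProd (· ∈ S) fun _ => ZMod 2).symm (w, v))

/-- `ρ` is a density matrix whose range is contained in the quantum code `Q`. -/
structure IsDensityMatrixOn {ι : Type*} [Fintype ι] [DecidableEq ι] (Q : QuantumCode ι)
    (ρ : Matrix (ι → ZMod 2) (ι → ZMod 2) ℂ) : Prop where
  posSemidef : ρ.PosSemidef
  trace : ρ.trace = 1
  range : ∀ v, ρ.mulVec v ∈ Q

/-- `Q` corrects the erasure of the qubits in `S`: some quantum channel, given by Kraus operators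
`R k` with `∑ (R k)ᴴ * R k = 1`, recovers every state of the code from the remaining qubits. -/
def CorrectsErasure {ι : Type*} [Fintype ι] [DecidableEq ι] (Q : QuantumCode ι)
    (S : Finset ι) : Prop :=
  ∃ (m : ℕ) (R : Fin m → Matrix (ι → ZMod 2) ({i // i ∉ S} → ZMod 2) ℂ),
    ∑ k, (R k).conjTranspose * R k = 1 ∧
    ∀ ρ, IsDensityMatrixOn Q ρ →
      ∑ k, R k * partialTrace S ρ * (R k).conjTranspose = ρ

/-- `Q` has parameters `[[n, k, ≥ d]]`, where `n` is the number of elements of `ι`: it encodes `k`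
qubits and corrects any `d - 1` erasures. -/
structure HasParameters {ι : Type*} [Fintype ι] [DecidableEq ι] (Q : QuantumCode ι)
    (k d : ℕ) : Prop where
  finrank_eq : Module.finrank ℂ Q = 2 ^ k
  correctsErasure : ∀ S : Finset ι, S.card < d → CorrectsErasure Q S

/-- The (unnormalized) coset state `∑ c ∈ C, |x + c⟩`. -/
def cosetState {ι : Type*} (C : BinaryCode ι) (x : ι → ZMod 2) : (ι → ZMod 2) → ℂ :=
  Set.indicator {y | y - x ∈ C} fun _ => 1

/-- The CSS quantum code of `C₂ ⊆ C₁`, spanned by the coset states of `C₂` in `C₁`. -/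
def cssCode {ι : Type*} (C₁ C₂ : BinaryCode ι) : QuantumCode ι :=
  Submodule.span ℂ (cosetState C₂ '' (C₁ : Set (ι → ZMod 2)))

/-- The CSS distance `min {wt(C₁ \ C₂), wt(C₂^⊥ \ C₁^⊥)}`, equal to `⊤` when both sets are
empty. -/
def cssDistance {ι : Type*} [Fintype ι] (C₁ C₂ : BinaryCode ι) : ℕ∞ :=
  ⨅ v ∈ ((C₁ : Set (ι → ZMod 2)) \ C₂) ∪ ((dual C₂ : Set (ι → ZMod 2)) \ dual C₁),
    (hammingNorm v : ℕ∞)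

end CSST

end

/-!
Let `n` be odd and let `ψ k = β ^ k` for `k` in `ℤ/n`. By Fourier inversion, `C(I)` consists of the
binary words `c` whose discrete Fourier transform `k ↦ ∑ c_j ψ (k j)` is supported in `I`
(`mem_cyclicCode_iff`). If `I = 2 I`, the words `Tr (a ψ (-k j))` with `k ∈ I` lie in `C(I)`, and
by the independence of the powers of the Frobenius automorphism a linear relation over `F` that
holds on `C(I)` also holds on the vectors `(ψ (-k j))_j` (`sum_mul_rootChar_eq_zero`). Hence
`C(I)` has dimension `|I|`, its dual is `C((-I)ᶜ)`, and inclusion of codes is inclusion of index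
sets.

A self-orthogonal binary code of even length lies in a self-dual code (`exists_isSelfDual_ge`).
Applied to the restrictions of `C₁` to the supports of words of `C₂`, this turns the CSS-T
condition into `C₂ ⊆ C₁` together with `∑ a_j b_j x_j = 0` for `a, b ∈ C₁` and `x ∈ C₂`
(`isCSSTPair_iff`; evenness is the case `a = b = x`). For cyclic codes this trilinear form may be
evaluated on the vectors `(ψ (-k j))_j`, where it is a character sum, so it vanishes exactly when
`0 ∉ I₁ + I₁ + I₂` (`triple_product_eq_zero_iff`).

The distance bound is the BCH bound for both parts. The spectrum of the dual of `C(I₂)` lies in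
`-J₂`, and for `i ∈ I₁` the condition on the triple sum says that `-(I₁ + i) ⊆ J₂`, so the spectrum
of `C(I₁)` lies in a translate of `-J₂` (`le_cssDistance_cyclicCode`).

For the quantum part, let `S` be a set of fewer qubits than the distance. Then the words of `C₁`
supported in `S` lie in `C₂`, and `C₁` and `C₂` have the same restriction to `S`. These two facts
give the Knill–Laflamme conditions for the Kraus operators of the partial trace over `S`, with
coefficients that are proportional to a projection, and the scaled adjoints of the Kraus operators
form a recovery channel (`exists_recovery`, `correctsErasure_cssCode`).
-/

noncomputable section

namespace CSST

/-! ### Duals and self-dual extensions -/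

section LinearCodes

variable {ι : Type*} [Fintype ι]

lemma mem_dual {C : BinaryCode ι} {y : ι → ZMod 2} : y ∈ dual C ↔ ∀ x ∈ C, x ⬝ᵥ y = 0 :=
  Iff.rfl

lemma mem_dual_comm {C : BinaryCode ι} {y : ι → ZMod 2} :
    y ∈ dual C ↔ ∀ x ∈ C, y ⬝ᵥ x = 0 := by
  simp only [mem_dual, dotProduct_comm]

lemma exists_mem_dual_of_notMem {C : BinaryCode ι} {y : ι → ZMod 2} (hy : y ∉ C) :
    ∃ v ∈ dual C, y ⬝ᵥ v ≠ 0 := by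
  classical
  obtain ⟨f, hfy, hf⟩ := Submodule.exists_le_ker_of_notMem hy
  have hv : ∀ w, w ⬝ᵥ (dotProductEquiv (ZMod 2) ι).symm f = f w := fun w => by
    rw [dotProduct_comm]
    exact congrArg (fun g => g w) ((dotProductEquiv (ZMod 2) ι).apply_symm_apply f)
  exact ⟨(dotProductEquiv (ZMod 2) ι).symm f, fun x hx => (hv x).trans (hf hx), by rwa [hv]⟩

lemma finrank_dual (C : BinaryCode ι) :
    Module.finrank (ZMod 2) (dual C) = Fintype.card ι - Module.finrank (ZMod 2) C := by
  have hnd : (dotProductBilin (ZMod 2) (ZMod 2) :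
      LinearMap.BilinForm (ZMod 2) (ι → ZMod 2)).Nondegenerate :=
    ⟨fun x hx => dotProduct_eq_zero_iff.1 hx,
      fun x hx => dotProduct_eq_zero_iff.1 fun w => (dotProduct_comm x w).trans (hx w)⟩
  have h := LinearMap.BilinForm.finrank_orthogonal hnd C
  rwa [Module.finrank_fintype_fun_eq_card] at h

lemma finrank_le_card (C : BinaryCode ι) : Module.finrank (ZMod 2) C ≤ Fintype.card ι :=
  (Submodule.finrank_le C).trans_eq (Module.finrank_fintype_fun_eq_card _)

lemma zmod_two_mul_self (a : ZMod 2) : a * a = a := by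
  revert a; decide

lemma dotProduct_self_eq_sum (x : ι → ZMod 2) : x ⬝ᵥ x = ∑ i, x i :=
  Finset.sum_congr rfl fun i _ => zmod_two_mul_self (x i)

lemma natCast_hammingNorm (x : ι → ZMod 2) : ((hammingNorm x : ℕ) : ZMod 2) = ∑ i, x i := by
  classical
  rw [hammingNorm, Finset.card_filter, Nat.cast_sum]
  refine Finset.sum_congr rfl fun i _ => ?_
  generalize x i = a
  revert a; decide

/-- A self-orthogonal binary code of even length lies in a self-dual code. On `dual D` the map
`x ↦ x ⬝ᵥ x` is linear, so its kernel has codimension at most one; for a maximal self-orthogonal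
`D` that is not self-dual, `D` has codimension at least two in `dual D`, which leaves room for a
further self-orthogonal vector. -/
theorem exists_isSelfDual_ge (heven : Even (Fintype.card ι)) {W : BinaryCode ι}
    (hW : W ≤ dual W) : ∃ D : BinaryCode ι, IsSelfDual D ∧ W ≤ D := by
  obtain ⟨D, hWD, hD⟩ := Finite.exists_le_maximal (p := fun D : BinaryCode ι => D ≤ dual D) hW
  refine ⟨D, ?_, hWD⟩
  by_contra hne
  have hlt : D < dual D := lt_of_le_of_ne hD.1 fun h => hne h.symm
  have hrank := Submodule.finrank_lt_finrank_of_lt hlt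
  have hdual := finrank_dual D
  have hle := finrank_le_card D
  let f : (ι → ZMod 2) →ₗ[ZMod 2] ZMod 2 := ∑ i, LinearMap.proj i
  have hf : ∀ x, f x = x ⬝ᵥ x := fun x => by
    rw [dotProduct_self_eq_sum]; simp [f]
  let g := f.domRestrict (dual D)
  have hg := LinearMap.finrank_range_add_finrank_ker g
  have hg1 : Module.finrank (ZMod 2) (LinearMap.range g) ≤ 1 :=
    (Submodule.finrank_le _).trans_eq (Module.finrank_self _)
  have hex : ∃ v ∈ dual D, v ⬝ᵥ v = 0 ∧ v ∉ D := by
    by_contra! hcon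
    have hsub : (LinearMap.ker g).map (dual D).subtype ≤ D := by
      rintro _ ⟨v, hv, rfl⟩
      exact hcon _ v.2 ((hf v).symm.trans hv)
    have h1 := Submodule.finrank_mono hsub
    rw [← (Submodule.equivMapOfInjective _ (dual D).subtype_injective _).finrank_eq] at h1
    obtain ⟨m, hm⟩ := heven
    omega
  obtain ⟨v, hv, hvv, hvD⟩ := hex
  have hsup : D ⊔ Submodule.span (ZMod 2) {v} ≤ dual (D ⊔ Submodule.span (ZMod 2) {v}) := by
    intro x hx y hy
    obtain ⟨a, ha, b, hb, rfl⟩ := Submodule.mem_sup.1 hx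
    obtain ⟨c, hc, d, hd, rfl⟩ := Submodule.mem_sup.1 hy
    obtain ⟨r, rfl⟩ := Submodule.mem_span_singleton.1 hb
    obtain ⟨t, rfl⟩ := Submodule.mem_span_singleton.1 hd
    have h1 : c ⬝ᵥ a = 0 := hD.1 ha c hc
    have h2 : c ⬝ᵥ v = 0 := hv c hc
    have h3 : v ⬝ᵥ a = 0 := (dotProduct_comm _ _).trans (hv a ha)
    simp [add_dotProduct, dotProduct_add, h1, h2, h3, hvv]
  exact hvD (hD.2 hsup le_sup_left
    (Submodule.mem_sup_right (Submodule.mem_span_singleton_self v)))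

variable [DecidableEq ι]

lemma dotProduct_extendByZero (S : Finset ι) (a : ι → ZMod 2) (d : {i // i ∉ S} → ZMod 2) :
    a ⬝ᵥ Function.ExtendByZero.linearMap (ZMod 2) (Subtype.val : {i // i ∉ S} → ι) d =
      (fun i : {i // i ∉ S} => a i) ⬝ᵥ d := by
  classical
  rw [dotProduct, ← Fintype.sum_subtype_add_sum_subtype (fun i => i ∉ S)]
  rw [Finset.sum_eq_zero (s := (Finset.univ : Finset {i // ¬ i ∉ S})) fun i _ => ?_, add_zero]
  · refine Finset.sum_congr rfl fun i _ => ?_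
    rw [Function.ExtendByZero.linearMap_apply, Subtype.val_injective.extend_apply]
  · rw [Function.ExtendByZero.linearMap_apply, Function.extend_apply', Pi.zero_apply, mul_zero]
    rintro ⟨j, hj⟩
    exact i.2 (hj ▸ j.2)

lemma sum_mul_mul_eq_dotProduct (a b x : ι → ZMod 2) :
    ∑ i, a i * b i * x i =
      (fun i : {i // i ∉ zeroSet x} => a i) ⬝ᵥ (fun i : {i // i ∉ zeroSet x} => b i) := by
  rw [← Fintype.sum_subtype_add_sum_subtype (fun i => i ∉ zeroSet x)]
  rw [Finset.sum_eq_zero (s := (Finset.univ : Finset {i // ¬ i ∉ zeroSet x})) fun i _ => ?_,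
    add_zero]
  · refine Finset.sum_congr rfl fun i _ => ?_
    have h : x i ≠ 0 := by simpa [zeroSet] using i.2
    have h1 : x i = 1 := Fin.eq_one_of_ne_zero _ h
    rw [h1]
    exact mul_one _
  · have h : x i = 0 := by simpa [zeroSet] using i.2
    rw [h, mul_zero]

/-- The CSS-T condition is orthogonality of `C₂` to all componentwise products of two words
of `C₁`. The shortening of the dual of `C₁` in the zeros of `x` is the dual of the restriction of
`C₁` to the support of `x`, so a self-dual code in it exists exactly when this restriction is
self-orthogonal. -/
theorem isCSSTPair_iff {C₁ C₂ : BinaryCode ι} :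
    IsCSSTPair C₁ C₂ ↔
      C₂ ≤ C₁ ∧ ∀ a ∈ C₁, ∀ b ∈ C₁, ∀ x ∈ C₂, ∑ i, a i * b i * x i = 0 := by
  constructor
  · rintro ⟨hle, -, hsd⟩
    refine ⟨hle, fun a ha b hb x hx => ?_⟩
    obtain ⟨D, hD, hDle⟩ := hsd x hx
    have hres : ∀ a ∈ C₁, (fun i : {i // i ∉ zeroSet x} => a i) ∈ D := by
      intro a ha
      rw [← hD, mem_dual_comm]
      intro d hd
      rw [← dotProduct_extendByZero]
      exact hDle hd a ha
    have ha' := hres a ha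
    rw [← hD, mem_dual_comm] at ha'
    rw [sum_mul_mul_eq_dotProduct]
    exact ha' _ (hres b hb)
  · rintro ⟨hle, h⟩
    have heven : IsEven C₂ := by
      intro c hc
      rw [even_iff_two_dvd, ← ZMod.natCast_eq_zero_iff, natCast_hammingNorm]
      simpa only [zmod_two_mul_self] using h c (hle hc) c (hle hc) c hc
    refine ⟨hle, heven, fun x hx => ?_⟩
    have hcard : Even (Fintype.card {i // i ∉ zeroSet x}) := by
      have h2 := heven x hx
      rw [hammingNorm] at h2
      rw [Fintype.card_subtype]
      simpa [zeroSet] using h2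
    let W : BinaryCode {i // i ∉ zeroSet x} :=
      C₁.map (LinearMap.funLeft (ZMod 2) (ZMod 2) (Subtype.val : {i // i ∉ zeroSet x} → ι))
    have hW : W ≤ dual W := by
      rintro _ ⟨b, hb, rfl⟩ _ ⟨a, ha, rfl⟩
      exact (sum_mul_mul_eq_dotProduct a b x).symm.trans (h a ha b hb x hx)
    obtain ⟨D, hD, hWD⟩ := exists_isSelfDual_ge hcard hW
    refine ⟨D, hD, fun d hd => ?_⟩
    intro a ha
    rw [dotProduct_extendByZero]
    rw [← hD] at hd
    exact hd _ (hWD ⟨a, ha, rfl⟩)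

end LinearCodes

/-! ### The spectrum of a word and the BCH bound -/

/-- Injectivity of a Vandermonde system: a relation among the vectors `(1, p, …, p ^ (N - 1))`
for at most `N` distinct points `p` is trivial. -/
lemma eq_zero_of_sum_mul_pow_eq_zero {F ι : Type*} [Field F] {A : Finset ι} {p : ι → F}
    (hp : Set.InjOn p A) {N : ℕ} (hN : A.card ≤ N) {a : ι → F}
    (h : ∀ t < N, ∑ i ∈ A, a i * p i ^ t = 0) : ∀ i ∈ A, a i = 0 := by
  classical
  have hpoly : ∀ g : Polynomial F, g.natDegree < N → ∑ i ∈ A, a i * g.eval (p i) = 0 := by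
    intro g hg
    simp_rw [Polynomial.eval_eq_sum_range, Finset.mul_sum]
    rw [Finset.sum_comm]
    refine Finset.sum_eq_zero fun t ht => ?_
    have := h t (by rw [Finset.mem_range] at ht; omega)
    rw [← mul_zero (g.coeff t), ← this, Finset.mul_sum]
    exact Finset.sum_congr rfl fun i _ => by ring
  intro i hi
  let g : Polynomial F := ∏ j ∈ A.erase i, (Polynomial.X - Polynomial.C (p j))
  have hdeg : g.natDegree < N := by
    rw [Polynomial.natDegree_prod_of_monic _ _ fun j _ => Polynomial.monic_X_sub_C _]
    simp only [Polynomial.natDegree_X_sub_C, Finset.sum_const, smul_eq_mul, mul_one]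
    exact (Finset.card_erase_lt_of_mem hi).trans_le hN
  have hsum := hpoly g hdeg
  rw [Finset.sum_eq_single_of_mem i hi] at hsum
  · refine (mul_eq_zero.1 hsum).resolve_right ?_
    rw [Polynomial.eval_prod]
    refine Finset.prod_ne_zero_iff.2 fun j hj => ?_
    rw [Finset.mem_erase] at hj
    simp only [Polynomial.eval_sub, Polynomial.eval_X, Polynomial.eval_C]
    exact sub_ne_zero.2 fun h => hj.1 (hp hj.2 hi h.symm)
  · intro j hj hji
    rw [Polynomial.eval_prod, Finset.prod_eq_zero (Finset.mem_erase.2 ⟨hji, hj⟩) (by simp),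
      mul_zero]

section Spectrum

variable {F : Type*} [Field F] {n : ℕ} [NeZero n] {β : F} (hβ : IsPrimitiveRoot β n)

/-- The additive character `k ↦ β ^ k` of `ℤ/n`. -/
def rootChar {F : Type*} [Field F] {n : ℕ} [NeZero n] {β : F} (hβ : IsPrimitiveRoot β n) :
    AddChar (ZMod n) F :=
  AddChar.zmodChar n hβ.pow_eq_one

lemma rootChar_natCast (k : ℕ) : rootChar hβ (k : ZMod n) = β ^ k :=
  AddChar.zmodChar_apply' hβ.pow_eq_one k

lemma rootChar_mul_natCast (k : ZMod n) (j : ℕ) : rootChar hβ (k * j) = rootChar hβ k ^ j := by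
  rw [mul_comm, ← nsmul_eq_mul, AddChar.map_nsmul_eq_pow]

lemma rootChar_injective : Function.Injective (rootChar hβ) := by
  intro k l h
  rw [← ZMod.natCast_zmod_val k, ← ZMod.natCast_zmod_val l, rootChar_natCast,
    rootChar_natCast] at h
  exact ZMod.val_injective n (hβ.pow_inj (ZMod.val_lt k) (ZMod.val_lt l) h)

lemma natCast_fin_injective {n : ℕ} : Function.Injective fun j : Fin n => ((j : ℕ) : ZMod n) := by
  intro i j h
  have h' := (ZMod.natCast_eq_natCast_iff _ _ _).1 h
  exact Fin.ext (Nat.ModEq.eq_of_lt_of_lt h' i.2 j.2)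

lemma natCast_fin_bijective : Function.Bijective fun j : Fin n => ((j : ℕ) : ZMod n) :=
  (Fintype.bijective_iff_injective_and_card _).2
    ⟨natCast_fin_injective, by rw [Fintype.card_fin, ZMod.card]⟩

lemma sum_rootChar_mul_zmod (j : ZMod n) :
    ∑ k : ZMod n, rootChar hβ (k * j) = if j = 0 then (n : F) else 0 := by
  have hprim : (rootChar hβ).IsPrimitive := AddChar.zmodChar_primitive_of_primitive_root n hβ
  rw [AddChar.sum_mulShift j hprim, ZMod.card]
  split_ifs <;> simp

lemma sum_rootChar_mul_fin (k : ZMod n) :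
    ∑ j : Fin n, rootChar hβ (k * (j : ℕ)) = if k = 0 then (n : F) else 0 := by
  rw [natCast_fin_bijective.sum_comp fun x : ZMod n => rootChar hβ (k * x),
    ← sum_rootChar_mul_zmod hβ k]
  simp_rw [mul_comm k]

/-- The discrete Fourier transform of `v` with respect to `β`, that is, the values of the
polynomial `∑ v_j x ^ j` at the powers of `β`. -/
def dft (v : Fin n → F) (k : ZMod n) : F :=
  ∑ j : Fin n, v j * rootChar hβ (k * (j : ℕ))

lemma sum_dft_mul_rootChar (v : Fin n → F) (j : Fin n) :
    ∑ k, dft hβ v k * rootChar hβ (-k * (j : ℕ)) = n * v j := by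
  simp_rw [dft, Finset.sum_mul]
  rw [Finset.sum_comm]
  have h : ∀ i : Fin n, ∑ k, v i * rootChar hβ (k * (i : ℕ)) * rootChar hβ (-k * (j : ℕ)) =
      if i = j then n * v j else 0 := by
    intro i
    have : ∀ k, v i * rootChar hβ (k * (i : ℕ)) * rootChar hβ (-k * (j : ℕ)) =
        v i * rootChar hβ (k * (((i : ℕ) : ZMod n) - ((j : ℕ) : ZMod n))) := by
      intro k
      rw [mul_assoc, ← AddChar.map_add_eq_mul]
      congr 2
      ring
    simp_rw [this]
    rw [← Finset.mul_sum, sum_rootChar_mul_zmod]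
    by_cases hij : i = j
    · subst hij; simp [mul_comm]
    · rw [if_neg hij, if_neg, mul_zero]
      exact sub_ne_zero.2 fun h => hij (natCast_fin_injective h)
  simp_rw [h]
  simp

/-- The BCH bound: a nonzero word whose spectrum vanishes at `N` consecutive points has more than
`N` nonzero coordinates. -/
theorem lt_hammingNorm_of_dft_eq_zero [DecidableEq F] {v : Fin n → F} (hv : v ≠ 0) {N : ℕ}
    {b : ZMod n} (h : ∀ t < N, dft hβ v (b + (t : ℕ)) = 0) : N < hammingNorm v := by
  classical
  by_contra! hle
  let A : Finset (Fin n) := Finset.univ.filter fun j => v j ≠ 0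
  have hinj : Set.InjOn (fun j : Fin n => rootChar hβ ((j : ℕ) : ZMod n)) A :=
    ((rootChar_injective hβ).comp natCast_fin_injective).injOn
  have key := eq_zero_of_sum_mul_pow_eq_zero (A := A) hinj (N := N) hle
    (a := fun j => v j * rootChar hβ (b * (j : ℕ))) (fun t ht => ?_)
  · refine hv (funext fun j => ?_)
    by_contra hj
    have := key j (by simpa [A] using hj)
    exact mul_ne_zero hj (AddChar.val_isUnit _ _).ne_zero this
  · rw [← h t ht, dft, Finset.sum_filter_of_ne]
    · refine Finset.sum_congr rfl fun j _ => ?_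
      rw [mul_assoc, ← rootChar_mul_natCast, ← AddChar.map_add_eq_mul]
      congr 2; ring
    · rintro j - hj h0
      exact hj (by rw [h0]; ring)

end Spectrum

/-! ### Cyclic codes in terms of the spectrum -/

section CyclicCodes

/-- A binary word regarded as a word over the extension field. -/
def baseExt (F : Type*) [Field F] [Algebra (ZMod 2) F] {n : ℕ} (c : Fin n → ZMod 2) :
    Fin n → F :=
  fun j => algebraMap (ZMod 2) F (c j)

lemma algebraMap_dotProduct {F : Type*} [Field F] [Algebra (ZMod 2) F] {n : ℕ}
    (c d : Fin n → ZMod 2) :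
    algebraMap (ZMod 2) F (c ⬝ᵥ d) = ∑ j, baseExt F c j * baseExt F d j := by
  simp [dotProduct, baseExt]

lemma odd_of_dvd_two_pow_sub_one {s n : ℕ} (hs : s ≠ 0) (hn : n ∣ 2 ^ s - 1) : Odd n := by
  refine Odd.of_dvd_nat ?_ hn
  exact Nat.Even.sub_odd Nat.one_le_two_pow ((Nat.even_pow' hs).2 even_two) odd_one

lemma natCast_eq_one_of_odd {F : Type*} [Field F] [Algebra (ZMod 2) F] {n : ℕ}
    (hn : Odd n) : (n : F) = 1 := by
  rw [← map_natCast (algebraMap (ZMod 2) F), (ZMod.natCast_eq_one_iff_odd).2 hn, map_one]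

lemma mem_evalCode_iff {F : Type*} [Field F] {n : ℕ} [NeZero n] {β : F}
    (hβ : IsPrimitiveRoot β n) (hn : (n : F) = 1) {I : Finset (ZMod n)}
    {v : Fin n → F} : v ∈ evalCode n β (negExponents I) ↔ ∀ k ∉ I, dft hβ v k = 0 := by
  have hev : ∀ k : ZMod n, ev n β (Polynomial.X ^ (-k).val) =
      fun j : Fin n => rootChar hβ (-k * (j : ℕ)) := by
    intro k
    funext j
    rw [mul_comm, ← ZMod.natCast_zmod_val (-k), ← Nat.cast_mul, rootChar_natCast,
      ZMod.natCast_zmod_val, pow_mul]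
    simp [ev, Polynomial.leval]
  constructor
  · intro hv k hk
    rw [evalCode, Submodule.map_span] at hv
    induction hv using Submodule.span_induction with
    | mem x hx =>
      obtain ⟨_, ⟨m, hm, rfl⟩, rfl⟩ := hx
      obtain ⟨i, hi, rfl⟩ := Finset.mem_image.1 hm
      rw [hev, dft]
      simp_rw [← AddChar.map_add_eq_mul, ← add_mul]
      rw [sum_rootChar_mul_fin, if_neg]
      rw [neg_add_eq_zero]
      rintro rfl
      exact hk hi
    | zero => simp [dft]
    | add x y _ _ hx hy =>
      simp only [dft] at hx hy
      simp [dft, add_mul, Finset.sum_add_distrib, hx, hy]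
    | smul r x _ hx =>
      simp only [dft] at hx
      simp [dft, mul_assoc, ← Finset.mul_sum, hx]
  · intro h
    have hv : v = ∑ k ∈ I, dft hβ v k • ev n β (Polynomial.X ^ (-k).val) := by
      funext j
      have := sum_dft_mul_rootChar hβ v j
      rw [hn, one_mul] at this
      rw [← this, Finset.sum_apply,
        ← Finset.sum_subset (Finset.subset_univ I) fun k _ hk => by rw [h k hk, zero_mul]]
      exact Finset.sum_congr rfl fun k _ => by rw [hev]; rfl
    rw [hv]
    refine Submodule.sum_mem _ fun k hk => Submodule.smul_mem _ _ ?_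
    exact Submodule.mem_map_of_mem
      (Submodule.subset_span ⟨_, Finset.mem_image_of_mem _ hk, rfl⟩)

lemma IsCyclotomicCoset.two_pow_mul_mem {n : ℕ} {I : Finset (ZMod n)} (hI : IsCyclotomicCoset I)
    {k : ZMod n} (hk : k ∈ I) (t : ℕ) : 2 ^ t * k ∈ I := by
  induction t with
  | zero => simpa using hk
  | succ t ih =>
    rw [hI, pow_succ', mul_assoc]
    exact Finset.mem_image_of_mem _ ih

variable {F : Type*} [Field F] [Algebra (ZMod 2) F] {n : ℕ} [NeZero n] {β : F}

lemma baseExt_eq_sum_dft (hβ : IsPrimitiveRoot β n) (hn : (n : F) = 1) (c : Fin n → ZMod 2)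
    (j : Fin n) :
    baseExt F c j = ∑ k, dft hβ (baseExt F c) k * rootChar hβ (-k * (j : ℕ)) := by
  rw [sum_dft_mul_rootChar, hn, one_mul]

/-- The words of `C(I)` are the binary words whose spectrum is supported in `I`. -/
theorem mem_cyclicCode_iff (hβ : IsPrimitiveRoot β n) (hn : (n : F) = 1) {I : Finset (ZMod n)}
    {c : Fin n → ZMod 2} : c ∈ cyclicCode β I ↔ ∀ k ∉ I, dft hβ (baseExt F c) k = 0 :=
  mem_evalCode_iff hβ hn

lemma cyclicCode_mono (hβ : IsPrimitiveRoot β n) (hn : (n : F) = 1) {I J : Finset (ZMod n)}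
    (h : I ⊆ J) : cyclicCode β I ≤ cyclicCode β J := fun _ hc =>
  (mem_cyclicCode_iff hβ hn).2 fun k hk => (mem_cyclicCode_iff hβ hn).1 hc k fun hI => hk (h hI)

lemma finrank_cyclicCode_le (hβ : IsPrimitiveRoot β n) (hn : (n : F) = 1)
    (I : Finset (ZMod n)) : Module.finrank (ZMod 2) (cyclicCode β I) ≤ I.card := by
  have hIn : I.card ≤ n := (Finset.card_le_univ I).trans_eq (ZMod.card n)
  let f : cyclicCode β I →ₗ[ZMod 2] (Fin I.card → ZMod 2) :=
    (LinearMap.funLeft (ZMod 2) (ZMod 2) (Fin.castLE hIn)).domRestrict (cyclicCode β I)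
  have hf : Function.Injective f := by
    rw [← LinearMap.ker_eq_bot, LinearMap.ker_eq_bot']
    rintro ⟨c, hc⟩ hc0
    have hc0' : ∀ t (ht : t < I.card), c ⟨t, ht.trans_le hIn⟩ = 0 := fun t ht =>
      congrFun hc0 ⟨t, ht⟩
    rw [mem_cyclicCode_iff hβ hn] at hc
    have hdft : ∀ k ∈ I, dft hβ (baseExt F c) k = 0 := by
      refine eq_zero_of_sum_mul_pow_eq_zero (p := fun k => rootChar hβ (-k))
        ((rootChar_injective hβ).comp neg_injective).injOn le_rfl fun t ht => ?_
      have := baseExt_eq_sum_dft hβ hn c ⟨t, ht.trans_le hIn⟩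
      rw [baseExt.eq_def, hc0' t ht, map_zero,
        ← Finset.sum_subset (Finset.subset_univ I) fun k _ hk => by rw [hc k hk, zero_mul]] at this
      rw [this]
      exact Finset.sum_congr rfl fun k _ => by rw [rootChar_mul_natCast]
    refine Subtype.ext (funext fun j => ?_)
    apply (algebraMap (ZMod 2) F).injective
    have := baseExt_eq_sum_dft hβ hn c j
    rw [Finset.sum_eq_zero fun k _ => ?_] at this
    · simpa [baseExt] using this
    · by_cases hk : k ∈ I
      · rw [hdft k hk, zero_mul]
      · rw [hc k hk, zero_mul]
  simpa using LinearMap.finrank_le_finrank_of_injective hf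

variable [Finite F]

/-- For `k ∈ I` and `a ∈ F`, the word with coordinates `Tr (a β ^ (-k j))` lies in `C(I)`. -/
lemma trace_mem_cyclicCode (hβ : IsPrimitiveRoot β n) (hn : (n : F) = 1) {I : Finset (ZMod n)}
    (hI : IsCyclotomicCoset I) {k : ZMod n} (hk : k ∈ I) (a : F) :
    (fun j : Fin n => Algebra.trace (ZMod 2) F (a * rootChar hβ (-k * (j : ℕ)))) ∈
      cyclicCode β I := by
  rw [mem_cyclicCode_iff hβ hn]
  intro l hl
  simp_rw [dft, baseExt, FiniteField.algebraMap_trace_eq_sum_pow, Finset.sum_mul]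
  rw [Finset.sum_comm]
  refine Finset.sum_eq_zero fun t _ => ?_
  have h : ∀ j : Fin n, (a * rootChar hβ (-k * (j : ℕ))) ^ Nat.card (ZMod 2) ^ t *
      rootChar hβ (l * (j : ℕ)) = a ^ 2 ^ t * rootChar hβ ((l - 2 ^ t * k) * (j : ℕ)) := by
    intro j
    rw [Nat.card_zmod, mul_pow, ← AddChar.map_nsmul_eq_pow, mul_assoc, ← AddChar.map_add_eq_mul]
    congr 2
    rw [nsmul_eq_mul]
    push_cast
    ring
  simp_rw [h]
  rw [← Finset.mul_sum, sum_rootChar_mul_fin, if_neg, mul_zero]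
  rw [sub_eq_zero]
  rintro rfl
  exact hl (hI.two_pow_mul_mem hk t)

/-- The `F`-span of `C(I)` contains the vectors `(β ^ (-k j))_j` for `k ∈ I`, in dual form: a
linear relation valid on `C(I)` is valid on these vectors. The relation applied to trace words is
a vanishing combination of powers of the Frobenius automorphism, so its coefficients are zero. -/
theorem sum_mul_rootChar_eq_zero (hβ : IsPrimitiveRoot β n) (hn : (n : F) = 1)
    {I : Finset (ZMod n)} (hI : IsCyclotomicCoset I) {g : Fin n → F}
    (hg : ∀ c ∈ cyclicCode β I, ∑ j, g j * baseExt F c j = 0) {k : ZMod n} (hk : k ∈ I) :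
    ∑ j : Fin n, g j * rootChar hβ (-k * (j : ℕ)) = 0 := by
  classical
  have : Fintype F := Fintype.ofFinite F
  set d := Module.finrank (ZMod 2) F with hd
  have hdpos : 0 < d := Module.finrank_pos
  have hcard : Fintype.card F = 2 ^ d := by
    rw [Module.card_eq_pow_finrank (K := ZMod 2), ZMod.card]
  let P : Polynomial F := ∑ t ∈ Finset.range d,
    Polynomial.C (∑ j : Fin n, g j * rootChar hβ (-k * (j : ℕ)) ^ 2 ^ t) * Polynomial.X ^ 2 ^ t
  have heval : ∀ a, P.eval a = 0 := by
    intro a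
    rw [← hg _ (trace_mem_cyclicCode hβ hn hI hk a)]
    simp_rw [P, Polynomial.eval_finsetSum, Polynomial.eval_mul, Polynomial.eval_C,
      Polynomial.eval_pow, Polynomial.eval_X, baseExt, FiniteField.algebraMap_trace_eq_sum_pow,
      Finset.mul_sum, Finset.sum_mul]
    rw [Finset.sum_comm]
    refine Finset.sum_congr rfl fun j _ => Finset.sum_congr rfl fun t _ => ?_
    rw [Nat.card_zmod, mul_pow]
    ring
  have hdeg : P.degree < Fintype.card F := by
    rw [hcard]
    refine (Polynomial.degree_sum_le _ _).trans_lt ?_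
    rw [Finset.sup_lt_iff (by exact_mod_cast WithBot.bot_lt_coe _)]
    intro t ht
    refine (Polynomial.degree_C_mul_X_pow_le _ _).trans_lt ?_
    exact_mod_cast Nat.pow_lt_pow_right one_lt_two (Finset.mem_range.1 ht)
  have hP : P = 0 :=
    Polynomial.eq_zero_of_degree_lt_of_eval_finset_eq_zero Finset.univ
      (by rwa [Finset.card_univ]) fun a _ => heval a
  have hcoeff := congrArg (fun Q => Polynomial.coeff Q 1) hP
  simp only [P, Polynomial.finsetSum_coeff, Polynomial.coeff_C_mul, Polynomial.coeff_X_pow,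
    Polynomial.coeff_zero] at hcoeff
  rw [Finset.sum_eq_single_of_mem 0 (Finset.mem_range.2 hdpos)] at hcoeff
  · simpa using hcoeff
  · intro t _ ht
    rw [if_neg, mul_zero]
    exact (Nat.one_lt_two_pow ht).ne

/-- The dual of `C(I)` is `C(J)` with `J` the complement of `-I`. -/
theorem dual_cyclicCode (hβ : IsPrimitiveRoot β n) (hn : (n : F) = 1) {I : Finset (ZMod n)}
    (hI : IsCyclotomicCoset I) : dual (cyclicCode β I) = cyclicCode β (-I)ᶜ := by
  ext d
  rw [mem_cyclicCode_iff hβ hn]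
  constructor
  · intro hd k hk
    rw [Finset.mem_compl, not_not, Finset.mem_neg'] at hk
    have := sum_mul_rootChar_eq_zero hβ hn hI (g := baseExt F d) (fun c hc => ?_) hk
    · rw [neg_neg] at this
      exact this
    · rw [← algebraMap_dotProduct, dotProduct_comm, hd c hc, map_zero]
  · intro hd c hc
    rw [mem_cyclicCode_iff hβ hn] at hc
    apply (algebraMap (ZMod 2) F).injective
    rw [algebraMap_dotProduct, map_zero]
    calc ∑ j : Fin n, baseExt F c j * baseExt F d j
        = ∑ j : Fin n, ∑ k, dft hβ (baseExt F c) k * rootChar hβ (-k * (j : ℕ)) * baseExt F d j :=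
          Finset.sum_congr rfl fun j _ => by
            rw [← Finset.sum_mul, ← baseExt_eq_sum_dft hβ hn]
      _ = ∑ k, dft hβ (baseExt F c) k * dft hβ (baseExt F d) (-k) := by
          rw [Finset.sum_comm]
          refine Finset.sum_congr rfl fun k _ => ?_
          rw [dft.eq_def hβ (baseExt F d), Finset.mul_sum]
          exact Finset.sum_congr rfl fun j _ => by ring
      _ = 0 := Finset.sum_eq_zero fun k _ => by
          by_cases hk : k ∈ I
          · rw [hd (-k) (by simpa using hk), mul_zero]
          · rw [hc k hk, zero_mul]

theorem finrank_cyclicCode (hβ : IsPrimitiveRoot β n) (hn : (n : F) = 1) {I : Finset (ZMod n)}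
    (hI : IsCyclotomicCoset I) : Module.finrank (ZMod 2) (cyclicCode β I) = I.card := by
  have h1 := finrank_cyclicCode_le hβ hn I
  have h2 := finrank_cyclicCode_le hβ hn (-I)ᶜ
  rw [← dual_cyclicCode hβ hn hI, finrank_dual, Finset.card_compl, Finset.card_neg, ZMod.card,
    Fintype.card_fin] at h2
  have hIn : I.card ≤ n := (Finset.card_le_univ I).trans_eq (ZMod.card n)
  omega

/-! ### The CSS-T condition for cyclic codes -/

lemma cyclicCode_le_iff (hβ : IsPrimitiveRoot β n) (hn : (n : F) = 1) {I J : Finset (ZMod n)}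
    (hI : IsCyclotomicCoset I) : cyclicCode β I ≤ cyclicCode β J ↔ I ⊆ J := by
  refine ⟨fun h k hk => ?_, cyclicCode_mono hβ hn⟩
  by_contra hkJ
  have := sum_mul_rootChar_eq_zero hβ hn hI (g := fun j => rootChar hβ (k * (j : ℕ)))
    (fun c hc => ?_) hk
  · simp_rw [← AddChar.map_add_eq_mul, ← add_mul, add_neg_cancel] at this
    rw [sum_rootChar_mul_fin, if_pos rfl, hn] at this
    exact one_ne_zero this
  · simp_rw [mul_comm]
    exact (mem_cyclicCode_iff hβ hn).1 (h hc) k hkJ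

/-- The trilinear form `∑ a_j b_j x_j` vanishes on `C(I₁) × C(I₁) × C(I₂)` exactly when no three
spectral points sum to zero: after extension of scalars the three codes are spanned by the vectors
`(β ^ (-k j))_j`, on which the form is a character sum. -/
theorem triple_product_eq_zero_iff (hβ : IsPrimitiveRoot β n) (hn : (n : F) = 1)
    {I₁ I₂ : Finset (ZMod n)} (hI₁ : IsCyclotomicCoset I₁) (hI₂ : IsCyclotomicCoset I₂) :
    (∀ a ∈ cyclicCode β I₁, ∀ b ∈ cyclicCode β I₁, ∀ x ∈ cyclicCode β I₂,
      ∑ j, a j * b j * x j = 0) ↔ (0 : ZMod n) ∉ I₁ + I₁ + I₂ := by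
  constructor
  · intro h h0
    obtain ⟨_, hij, k, hk, hsum⟩ := Finset.mem_add.1 h0
    obtain ⟨i, hi, l, hl, rfl⟩ := Finset.mem_add.1 hij
    have h1 : ∀ b ∈ cyclicCode β I₁, ∀ x ∈ cyclicCode β I₂,
        ∑ j : Fin n, baseExt F b j * baseExt F x j * rootChar hβ (-i * (j : ℕ)) = 0 := by
      intro b hb x hx
      refine sum_mul_rootChar_eq_zero hβ hn hI₁ (fun a ha => ?_) hi
      rw [← map_zero (algebraMap (ZMod 2) F), ← h a ha b hb x hx, map_sum]
      refine Finset.sum_congr rfl fun j _ => ?_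
      simp only [baseExt, map_mul]
      ring
    have h2 : ∀ x ∈ cyclicCode β I₂, ∑ j : Fin n, baseExt F x j * rootChar hβ (-i * (j : ℕ)) *
        rootChar hβ (-l * (j : ℕ)) = 0 := by
      intro x hx
      refine sum_mul_rootChar_eq_zero hβ hn hI₁ (fun b hb => ?_) hl
      rw [← h1 b hb x hx]
      exact Finset.sum_congr rfl fun j _ => by ring
    have h3 : ∑ j : Fin n, rootChar hβ (-i * (j : ℕ)) * rootChar hβ (-l * (j : ℕ)) *
        rootChar hβ (-k * (j : ℕ)) = 0 := by
      refine sum_mul_rootChar_eq_zero hβ hn hI₂ (fun x hx => ?_) hk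
      rw [← h2 x hx]
      exact Finset.sum_congr rfl fun j _ => by ring
    simp_rw [← AddChar.map_add_eq_mul, ← add_mul] at h3
    rw [sum_rootChar_mul_fin, if_pos (by linear_combination -hsum), hn] at h3
    exact one_ne_zero h3
  · intro h a ha b hb x hx
    rw [mem_cyclicCode_iff hβ hn] at ha hb hx
    apply (algebraMap (ZMod 2) F).injective
    rw [map_zero, map_sum]
    have hinv : ∀ (c : Fin n → ZMod 2) (j : Fin n), algebraMap (ZMod 2) F (c j) =
        ∑ k, dft hβ (baseExt F c) k * rootChar hβ (-k * (j : ℕ)) :=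
      baseExt_eq_sum_dft hβ hn
    have hterm : ∀ j : Fin n, algebraMap (ZMod 2) F (a j * b j * x j) =
        ∑ i, ∑ l, ∑ k, dft hβ (baseExt F a) i * dft hβ (baseExt F b) l *
          dft hβ (baseExt F x) k * rootChar hβ (-(i + l + k) * (j : ℕ)) := by
      intro j
      rw [map_mul, map_mul, hinv a, hinv b, hinv x, Finset.sum_mul_sum, Finset.sum_mul]
      refine Finset.sum_congr rfl fun i _ => ?_
      rw [Finset.sum_mul]
      refine Finset.sum_congr rfl fun l _ => ?_
      rw [Finset.mul_sum]
      refine Finset.sum_congr rfl fun k _ => ?_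
      rw [show -(i + l + k) * ((j : ℕ) : ZMod n) =
        -i * (j : ℕ) + -l * (j : ℕ) + -k * (j : ℕ) by ring, AddChar.map_add_eq_mul,
        AddChar.map_add_eq_mul]
      ring
    simp_rw [hterm]
    rw [Finset.sum_comm]
    refine Finset.sum_eq_zero fun i _ => ?_
    rw [Finset.sum_comm]
    refine Finset.sum_eq_zero fun l _ => ?_
    rw [Finset.sum_comm]
    refine Finset.sum_eq_zero fun k _ => ?_
    rw [← Finset.mul_sum, sum_rootChar_mul_fin]
    split_ifs with h0
    · by_cases hi : i ∈ I₁
      · by_cases hl : l ∈ I₁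
        · by_cases hk : k ∈ I₂
          · exact absurd (Finset.mem_add.2 ⟨_, Finset.mem_add.2 ⟨i, hi, l, hl, rfl⟩, k, hk,
              neg_eq_zero.1 h0⟩) h
          · rw [hx k hk]; ring
        · rw [hb l hl]; ring
      · rw [ha i hi]; ring
    · rw [mul_zero]

end CyclicCodes

/-! ### Amplitude and distance -/

section Amplitude

variable {n : ℕ} [NeZero n]

lemma mem_interval_lengths (I : Finset (ZMod n)) :
    n ∈ {a : ℕ | ∃ c : ZMod n, ∀ i ∈ I, ∃ t : ℕ, t < a ∧ i = c + (t : ZMod n)} :=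
  ⟨0, fun i _ => ⟨i.val, ZMod.val_lt i, by rw [zero_add, ZMod.natCast_zmod_val]⟩⟩

lemma amplitude_le (I : Finset (ZMod n)) : amplitude I ≤ n :=
  Nat.sInf_le (mem_interval_lengths I)

lemma exists_forall_mem_amplitude (I : Finset (ZMod n)) :
    ∃ c : ZMod n, ∀ i ∈ I, ∃ t : ℕ, t < amplitude I ∧ i = c + (t : ZMod n) :=
  Nat.sInf_mem ⟨n, mem_interval_lengths I⟩

variable {F : Type*} [Field F] [Algebra (ZMod 2) F] {β : F}

lemma hammingNorm_baseExt {F : Type*} [Field F] [Algebra (ZMod 2) F] [DecidableEq F] {n : ℕ}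
    (v : Fin n → ZMod 2) :
    hammingNorm (baseExt F v) = hammingNorm v :=
  hammingNorm_comp (fun _ => algebraMap (ZMod 2) F) (fun _ => (algebraMap (ZMod 2) F).injective)
    (fun _ => map_zero _)

/-- The BCH bound in terms of amplitude, for a spectrum supported in `r - J`. -/
lemma lt_hammingNorm_of_dft_support (hβ : IsPrimitiveRoot β n) {J : Finset (ZMod n)}
    {v : Fin n → ZMod 2} (hv : v ≠ 0) (r : ZMod n)
    (h : ∀ k, r - k ∉ J → dft hβ (baseExt F v) k = 0) :
    n - amplitude J < hammingNorm v := by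
  classical
  obtain ⟨c, hc⟩ := exists_forall_mem_amplitude J
  have hle := amplitude_le J
  rw [← hammingNorm_baseExt (F := F)]
  -- `r - J` lies in the interval from `r - c - (a - 1)` to `r - c`, where `a` is the amplitude.
  refine lt_hammingNorm_of_dft_eq_zero hβ (b := r - c + 1) (fun h0 => hv ?_) fun t ht => h _ ?_
  · funext j
    have := congrFun h0 j
    simpa [baseExt] using this
  · intro hmem
    obtain ⟨u, hu, heq⟩ := hc _ hmem
    have h0 : ((t + u + 1 : ℕ) : ZMod n) = 0 := by
      push_cast
      linear_combination -heq
    rw [ZMod.natCast_eq_zero_iff] at h0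
    have := Nat.le_of_dvd (by omega) h0
    omega

/-- Both parts of the CSS distance are bounded by BCH. The spectrum of the dual of `C(I₂)` lies in
`-J` with `J` the complement of `I₂`; if `i ∈ I₁`, then `-(I₁ + i)` avoids `I₂`, so the spectrum
of `C(I₁)` lies in the translate `-i - J` of the same set. -/
theorem le_cssDistance_cyclicCode [Finite F] (hβ : IsPrimitiveRoot β n) (hn : (n : F) = 1)
    {I₁ I₂ : Finset (ZMod n)} (hI₂ : IsCyclotomicCoset I₂)
    (h : (0 : ZMod n) ∉ I₁ + I₁ + I₂) :
    ((n - amplitude I₂ᶜ + 1 : ℕ) : ℕ∞) ≤ cssDistance (cyclicCode β I₁) (cyclicCode β I₂) := by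
  refine le_iInf₂ fun v hv => ?_
  rw [Nat.cast_le, Nat.succ_le_iff]
  rcases hv with ⟨hv₁, hv₂⟩ | ⟨hv₁, hv₂⟩
  · have hv0 : v ≠ 0 := fun h0 => hv₂ (h0 ▸ Submodule.zero_mem _)
    have hspec := (mem_cyclicCode_iff hβ hn).1 hv₁
    obtain ⟨i, hi⟩ : I₁.Nonempty := by
      rw [Finset.nonempty_iff_ne_empty]
      rintro rfl
      have hfin := finrank_cyclicCode_le hβ hn (∅ : Finset (ZMod n))
      rw [Finset.card_empty, Nat.le_zero, Submodule.finrank_eq_zero] at hfin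
      rw [hfin] at hv₁
      exact hv0 hv₁
    refine lt_hammingNorm_of_dft_support hβ hv0 (-i) fun k hk => hspec k fun hkI => h ?_
    rw [Finset.mem_compl, not_not] at hk
    exact Finset.mem_add.2 ⟨_, Finset.add_mem_add hi hkI, _, hk, by ring⟩
  · have hv0 : v ≠ 0 := fun h0 => hv₂ (h0 ▸ Submodule.zero_mem _)
    rw [SetLike.mem_coe, dual_cyclicCode hβ hn hI₂, mem_cyclicCode_iff hβ hn] at hv₁
    refine lt_hammingNorm_of_dft_support hβ hv0 0 fun k hk => hv₁ k ?_
    simpa using hk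

end Amplitude

/-! ### Dimension of CSS quantum codes -/

section CSSCode

variable {ι : Type*}

lemma cosetState_apply {C : BinaryCode ι} [DecidablePred (· ∈ C)] (x y : ι → ZMod 2) :
    cosetState C x y = if y - x ∈ C then 1 else 0 := by
  classical
  simp [cosetState, Set.indicator_apply]

lemma cosetState_eq_of_sub_mem {C : BinaryCode ι} {x y : ι → ZMod 2} (h : x - y ∈ C) :
    cosetState C x = cosetState C y := by
  classical
  funext z
  rw [cosetState_apply, cosetState_apply]
  refine if_congr ?_ rfl rfl
  rw [← sub_add_sub_cancel z x y, Submodule.add_mem_iff_left _ h]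

/-- The coset states have disjoint supports, so the dimension of the CSS code is the number of
cosets of `C₂` in `C₁`. -/
theorem finrank_cssCode [Finite ι] {C₁ C₂ : BinaryCode ι} (h : C₂ ≤ C₁) :
    Module.finrank ℂ (cssCode C₁ C₂) =
      2 ^ (Module.finrank (ZMod 2) C₁ - Module.finrank (ZMod 2) C₂) := by
  classical
  let K : Submodule (ZMod 2) C₁ := C₂.comap C₁.subtype
  have : Finite (C₁ ⧸ K) := Finite.of_surjective _ (Submodule.mkQ_surjective K)
  have : Fintype (C₁ ⧸ K) := Fintype.ofFinite _
  let rep : C₁ ⧸ K → ι → ZMod 2 := fun q => (Quotient.out q : C₁)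
  have hrep : ∀ q q', rep q - rep q' ∈ C₂ → q = q' := by
    intro q q' hq
    rw [← Submodule.Quotient.mk_out q, ← Submodule.Quotient.mk_out q', Submodule.Quotient.eq]
    exact hq
  let b : C₁ ⧸ K → (ι → ZMod 2) → ℂ := fun q => cosetState C₂ (rep q)
  have hb : LinearIndependent ℂ b := by
    rw [Fintype.linearIndependent_iff]
    intro g hg q
    have := congrFun hg (rep q)
    rw [Finset.sum_apply, Finset.sum_eq_single q] at this
    · simpa [b, cosetState_apply] using this
    · intro q' _ hne
      rw [Pi.smul_apply, show b q' (rep q) = _ from cosetState_apply _ _, if_neg, smul_zero]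
      exact fun hmem => hne (hrep _ _ hmem).symm
    · simp
  have hspan : cssCode C₁ C₂ = Submodule.span ℂ (Set.range b) := by
    refine congrArg _ (Set.Subset.antisymm ?_ ?_)
    · rintro _ ⟨x, hx, rfl⟩
      refine ⟨Submodule.Quotient.mk ⟨x, hx⟩, cosetState_eq_of_sub_mem ?_⟩
      have := (Submodule.Quotient.eq K).1
        (Submodule.Quotient.mk_out (Submodule.Quotient.mk (p := K) ⟨x, hx⟩))
      exact this
    · rintro _ ⟨q, rfl⟩
      exact ⟨rep q, (Quotient.out q : C₁).2, rfl⟩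
  rw [hspan, finrank_span_eq_card hb, Module.card_eq_pow_finrank (K := ZMod 2), ZMod.card]
  have hq := Submodule.finrank_quotient_add_finrank K
  have hK : Module.finrank (ZMod 2) K = Module.finrank (ZMod 2) C₂ :=
    (Submodule.comapSubtypeEquivOfLe h).finrank_eq
  congr 1
  omega

end CSSCode

/-! ### Recovery from Knill–Laflamme conditions -/

/-- A recovery channel for a noise channel with Kraus operators `D w` and a code with projection
`P`. The first condition on `c` is the Knill–Laflamme condition; the second says that the matrix
`κ⁻¹ c` fixes the family of restricted operators `D w * P`, so that
`κ⁻¹ ∑ D w * P * (D w)ᴴ` is the projection `G` onto the sum of their ranges. The recovery consists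
of the scaled adjoints `κ ^ (-1/2) P (D w)ᴴ`, completed to a channel by `V * (1 - G)` for an
isometry `V`, which does not contribute on the noisy code states. -/
theorem exists_recovery {H T W : Type*} [Fintype H] [Fintype T] [Fintype W]
    [DecidableEq H] [DecidableEq T] {D : W → Matrix T H ℂ} {P : Matrix H H ℂ}
    (hP : P.conjTranspose = P) (hPP : P * P = P) {V : Matrix H T ℂ}
    (hV : V.conjTranspose * V = 1) {c : W → W → ℝ} {κ : ℝ} (hκ : 0 < κ)
    (hKL : ∀ w w', P * (D w).conjTranspose * (D w' * P) = (c w w' : ℂ) • P)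
    (hfix : ∀ w', ∑ w, (c w w' : ℂ) • (D w * P) = (κ : ℂ) • (D w' * P))
    (hc : ∑ w, ∑ w', c w w' * c w w' = κ) :
    ∃ R : Option W → Matrix H T ℂ, ∑ k, (R k).conjTranspose * R k = 1 ∧
      ∀ ρ : Matrix H H ℂ, P * ρ = ρ → ρ * P = ρ →
        ∑ k, R k * (∑ w, D w * ρ * (D w).conjTranspose) * (R k).conjTranspose = ρ := by
  set r : ℂ := ((Real.sqrt κ⁻¹ : ℝ) : ℂ) with hr
  have hrr : r * r = (κ : ℂ)⁻¹ := by
    rw [hr, ← Complex.ofReal_mul, Real.mul_self_sqrt (inv_nonneg.2 hκ.le), Complex.ofReal_inv]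
  have hrstar : star r = r := Complex.conj_ofReal _
  have hκ0 : (κ : ℂ) ≠ 0 := Complex.ofReal_ne_zero.2 hκ.ne'
  set G : Matrix T T ℂ := (κ : ℂ)⁻¹ • ∑ w, D w * P * (P * (D w).conjTranspose) with hG
  have hGD : ∀ w', G * (D w' * P) = D w' * P := by
    intro w'
    rw [hG, Matrix.smul_mul, Matrix.sum_mul]
    simp_rw [Matrix.mul_assoc (D _ * P), hKL, Matrix.mul_smul, Matrix.mul_assoc (D _) P P, hPP]
    rw [hfix, smul_smul, inv_mul_cancel₀ hκ0, one_smul]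
  have hGG : G * G = G := by
    conv_rhs => rw [hG]
    nth_rewrite 2 [hG]
    rw [Matrix.mul_smul, Matrix.mul_sum]
    refine congrArg _ (Finset.sum_congr rfl fun w _ => ?_)
    rw [← Matrix.mul_assoc G, hGD]
  have hGstar : G.conjTranspose = G := by
    rw [hG, Matrix.conjTranspose_smul, Matrix.conjTranspose_sum, star_inv₀]
    simp only [Matrix.conjTranspose_mul, Matrix.conjTranspose_conjTranspose, hP]
    rw [show star (κ : ℂ) = κ from Complex.conj_ofReal κ]
  refine ⟨fun k => k.elim (V * (1 - G)) fun w => r • (P * (D w).conjTranspose), ?_, ?_⟩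
  · rw [Fintype.sum_option]
    simp only [Option.elim_none, Option.elim_some]
    have h1 : (V * (1 - G)).conjTranspose * (V * (1 - G)) = 1 - G := by
      rw [Matrix.conjTranspose_mul, Matrix.conjTranspose_sub, hGstar, Matrix.conjTranspose_one,
        Matrix.mul_assoc, ← Matrix.mul_assoc V.conjTranspose, hV, Matrix.one_mul, Matrix.sub_mul,
        Matrix.one_mul, Matrix.mul_sub, Matrix.mul_one, hGG, sub_self, sub_zero]
    have h2 : ∀ w, (r • (P * (D w).conjTranspose)).conjTranspose * (r • (P * (D w).conjTranspose))
        = (κ : ℂ)⁻¹ • (D w * P * (P * (D w).conjTranspose)) := by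
      intro w
      rw [Matrix.conjTranspose_smul, Matrix.smul_mul, Matrix.mul_smul, smul_smul, hrstar, hrr,
        Matrix.conjTranspose_mul, Matrix.conjTranspose_conjTranspose, hP]
    simp_rw [h1, h2]
    rw [← Finset.smul_sum, ← hG, sub_add_cancel]
  · intro ρ hPρ hρP
    rw [Fintype.sum_option]
    simp only [Option.elim_none, Option.elim_some]
    have h1 : V * (1 - G) * (∑ w, D w * ρ * (D w).conjTranspose) = 0 := by
      rw [Matrix.mul_assoc, Matrix.mul_sum, Finset.sum_eq_zero fun w _ => ?_, Matrix.mul_zero]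
      rw [← hPρ, ← Matrix.mul_assoc (D w), Matrix.mul_assoc (D w * P), ← Matrix.mul_assoc,
        Matrix.sub_mul, Matrix.one_mul, hGD, sub_self, Matrix.zero_mul]
    have hρ : ρ = P * ρ * P := by rw [hPρ, hρP]
    have hKL' : ∀ w w', P * (D w').conjTranspose * (D w * P) = (c w w' : ℂ) • P := by
      intro w w'
      have := congrArg Matrix.conjTranspose (hKL w w')
      simpa [Matrix.conjTranspose_mul, hP, Matrix.mul_assoc] using this
    have h2 : ∀ w w', r • (P * (D w).conjTranspose) * (D w' * ρ * (D w').conjTranspose) *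
        (r • (P * (D w).conjTranspose)).conjTranspose =
        ((κ : ℂ)⁻¹ * ((c w w' * c w w' : ℝ) : ℂ)) • ρ := by
      intro w w'
      rw [Matrix.conjTranspose_smul, hrstar, Matrix.conjTranspose_mul,
        Matrix.conjTranspose_conjTranspose, hP]
      calc r • (P * (D w).conjTranspose) * (D w' * ρ * (D w').conjTranspose) * (r • (D w * P))
          = (r * r) • ((P * (D w).conjTranspose * (D w' * P)) * ρ *
              (P * (D w').conjTranspose * (D w * P))) := by
            conv_lhs => rw [hρ]
            simp only [Matrix.smul_mul, Matrix.mul_smul, smul_smul, Matrix.mul_assoc]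
        _ = _ := by
            rw [hKL, hKL' w w', hrr, Matrix.smul_mul, Matrix.smul_mul, Matrix.mul_smul, hPρ, hρP,
              smul_smul, smul_smul, Complex.ofReal_mul, mul_assoc]
    rw [h1, Matrix.zero_mul, zero_add]
    simp_rw [Matrix.mul_sum, Matrix.sum_mul, h2, ← Finset.sum_smul, ← Finset.mul_sum,
      ← Complex.ofReal_sum]
    rw [hc, inv_mul_cancel₀ hκ0, one_smul]

/-! ### Erasure correction for CSS codes -/

section Erasure

variable {ι : Type*} [DecidableEq ι]

/-- The word equal to `w` on `S` and to `u` off `S`. -/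
def glue {ι : Type*} [DecidableEq ι] (S : Finset ι) (w : {i // i ∈ S} → ZMod 2)
    (u : {i // i ∉ S} → ZMod 2) : ι → ZMod 2 :=
  (Equiv.piEquivPiSubtypeProd (· ∈ S) fun _ => ZMod 2).symm (w, u)

lemma glue_apply_mem {S : Finset ι} (w : {i // i ∈ S} → ZMod 2) (u : {i // i ∉ S} → ZMod 2)
    {i : ι} (hi : i ∈ S) : glue S w u i = w ⟨i, hi⟩ := by
  simp [glue, hi]

lemma glue_apply_notMem {S : Finset ι} (w : {i // i ∈ S} → ZMod 2) (u : {i // i ∉ S} → ZMod 2)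
    {i : ι} (hi : i ∉ S) : glue S w u i = u ⟨i, hi⟩ := by
  simp [glue, hi]

lemma glue_sub (S : Finset ι) (w w' : {i // i ∈ S} → ZMod 2) (u u' : {i // i ∉ S} → ZMod 2) :
    glue S (w - w') (u - u') = glue S w u - glue S w' u' := by
  funext i
  by_cases hi : i ∈ S
  · simp [glue_apply_mem _ _ hi]
  · simp [glue_apply_notMem _ _ hi]

lemma glue_zero (S : Finset ι) : glue S 0 0 = 0 := by
  have := glue_sub S 0 0 0 0
  simpa using this

lemma glue_restrict (S : Finset ι) (y : ι → ZMod 2) :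
    glue S (fun i => y i) (fun i => y i) = y :=
  (Equiv.piEquivPiSubtypeProd (· ∈ S) fun _ => ZMod 2).symm_apply_apply y

variable [Fintype ι]

lemma sum_glue {M : Type*} [AddCommMonoid M] (S : Finset ι) (f : (ι → ZMod 2) → M) :
    ∑ w, ∑ u, f (glue S w u) = ∑ y, f y := by
  rw [← Fintype.sum_prod_type' (f := fun w u => f (glue S w u))]
  exact (Equiv.piEquivPiSubtypeProd (· ∈ S) fun _ => ZMod 2).symm.sum_comp f

open Classical in
/-- The indicator function of a code. -/
def ind {ι : Type*} (C : BinaryCode ι) (y : ι → ZMod 2) : ℝ := if y ∈ C then 1 else 0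

lemma ind_of_mem {ι : Type*} {C : BinaryCode ι} {y : ι → ZMod 2} (h : y ∈ C) : ind C y = 1 :=
  if_pos h

lemma ind_of_notMem {ι : Type*} {C : BinaryCode ι} {y : ι → ZMod 2} (h : y ∉ C) : ind C y = 0 :=
  if_neg h

lemma ind_nonneg {ι : Type*} (C : BinaryCode ι) (y : ι → ZMod 2) : 0 ≤ ind C y := by
  unfold ind; split_ifs <;> norm_num

lemma ind_neg {ι : Type*} (C : BinaryCode ι) (y : ι → ZMod 2) : ind C (-y) = ind C y := by
  classical exact if_congr C.neg_mem_iff rfl rfl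

lemma ind_add_of_mem {ι : Type*} {C : BinaryCode ι} {x : ι → ZMod 2} (hx : x ∈ C)
    (y : ι → ZMod 2) : ind C (x + y) = ind C y := by
  classical exact if_congr (C.add_mem_iff_right hx) rfl rfl

/-- The number of words of a code, as a real number. -/
def size {ι : Type*} [Fintype ι] [DecidableEq ι] (C : BinaryCode ι) : ℝ := ∑ y, ind C y

lemma size_pos (C : BinaryCode ι) : 0 < size C :=
  Finset.sum_pos' (fun y _ => ind_nonneg C y)
    ⟨0, Finset.mem_univ _, by rw [ind_of_mem C.zero_mem]; exact one_pos⟩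

lemma sum_ind_sub (C : BinaryCode ι) (y : ι → ZMod 2) : ∑ z, ind C (y - z) = size C :=
  (Equiv.subLeft y).sum_comp (ind C)

/-- The orthogonal projection onto the CSS code of `C₂ ⊆ C₁`. -/
def codeProj {ι : Type*} [Fintype ι] [DecidableEq ι] (C₁ C₂ : BinaryCode ι) :
    Matrix (ι → ZMod 2) (ι → ZMod 2) ℂ :=
  fun y z => (((size C₂)⁻¹ * (ind C₁ y * ind C₂ (y - z)) : ℝ) : ℂ)

lemma ind_mul_ind_sub_comm {ι : Type*} {C₁ C₂ : BinaryCode ι} (h : C₂ ≤ C₁) (y z : ι → ZMod 2) :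
    ind C₁ y * ind C₂ (y - z) = ind C₁ z * ind C₂ (z - y) := by
  rw [← ind_neg C₂ (z - y), neg_sub]
  by_cases hyz : y - z ∈ C₂
  · rw [← ind_add_of_mem (h hyz) z, sub_add_cancel]
  · rw [ind_of_notMem hyz, mul_zero, mul_zero]

lemma conjTranspose_codeProj {C₁ C₂ : BinaryCode ι} (h : C₂ ≤ C₁) :
    (codeProj C₁ C₂).conjTranspose = codeProj C₁ C₂ := by
  ext y z
  rw [Matrix.conjTranspose_apply, codeProj, codeProj, ind_mul_ind_sub_comm h]
  exact Complex.conj_ofReal _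

lemma ind_sub_mul_ind_sub {ι : Type*} (C : BinaryCode ι) (y z t : ι → ZMod 2) :
    ind C (y - z) * ind C (z - t) = ind C (y - z) * ind C (y - t) := by
  by_cases hyz : y - z ∈ C
  · rw [← ind_add_of_mem hyz (z - t), sub_add_sub_cancel]
  · rw [ind_of_notMem hyz, zero_mul, zero_mul]

lemma codeProj_mul_self {C₁ C₂ : BinaryCode ι} (h : C₂ ≤ C₁) :
    codeProj C₁ C₂ * codeProj C₁ C₂ = codeProj C₁ C₂ := by
  ext y t
  simp only [Matrix.mul_apply, codeProj, ← Complex.ofReal_mul, ← Complex.ofReal_sum]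
  congr 1
  have hterm : ∀ z, (size C₂)⁻¹ * (ind C₁ y * ind C₂ (y - z)) *
      ((size C₂)⁻¹ * (ind C₁ z * ind C₂ (z - t))) =
      (size C₂)⁻¹ * (size C₂)⁻¹ * (ind C₁ y * ind C₂ (y - t)) * ind C₂ (y - z) := by
    intro z
    by_cases hyz : y - z ∈ C₂
    · have h1 : ind C₁ y = ind C₁ z := by
        rw [← ind_add_of_mem (h hyz) z, sub_add_cancel]
      have h2 := ind_sub_mul_ind_sub C₂ y z t
      rw [ind_of_mem hyz, one_mul, one_mul] at h2
      have h3 : ind C₁ z * ind C₁ z = ind C₁ z := by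
        unfold ind; split_ifs <;> norm_num
      rw [ind_of_mem hyz, h1, h2]
      linear_combination (size C₂)⁻¹ * (size C₂)⁻¹ * ind C₂ (y - t) * h3
    · rw [ind_of_notMem hyz]; ring
  rw [Finset.sum_congr rfl fun z _ => hterm z, ← Finset.mul_sum, sum_ind_sub]
  field_simp [(size_pos C₂).ne']

lemma codeProj_mulVec {C₁ C₂ : BinaryCode ι} (h : C₂ ≤ C₁) {v : (ι → ZMod 2) → ℂ}
    (hv : v ∈ cssCode C₁ C₂) : (codeProj C₁ C₂).mulVec v = v := by
  classical
  induction hv using Submodule.span_induction with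
  | mem v hv =>
    obtain ⟨x, hx, rfl⟩ := hv
    have hcs : ∀ y, cosetState C₂ x y = (ind C₂ (y - x) : ℂ) := by
      intro y
      rw [cosetState_apply, ind]
      split_ifs <;> simp
    funext y
    simp only [Matrix.mulVec, dotProduct, codeProj, hcs, ← Complex.ofReal_mul,
      ← Complex.ofReal_sum]
    congr 1
    have hterm : ∀ z, (size C₂)⁻¹ * (ind C₁ y * ind C₂ (y - z)) * ind C₂ (z - x) =
        (size C₂)⁻¹ * (ind C₁ y * ind C₂ (y - x)) * ind C₂ (y - z) := fun z => by
      linear_combination (size C₂)⁻¹ * ind C₁ y * ind_sub_mul_ind_sub C₂ y z x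
    rw [Finset.sum_congr rfl fun z _ => hterm z, ← Finset.mul_sum, sum_ind_sub]
    by_cases hyx : y - x ∈ C₂
    · have hy : y ∈ C₁ := by simpa using C₁.add_mem (h hyx) hx
      rw [ind_of_mem hy]
      field_simp [(size_pos C₂).ne']
    · rw [ind_of_notMem hyx]; ring
  | zero => exact Matrix.mulVec_zero _
  | add x y _ _ hx hy => rw [Matrix.mulVec_add, hx, hy]
  | smul r x _ hx => rw [Matrix.mulVec_smul, hx]

lemma IsDensityMatrixOn.codeProj_mul {C₁ C₂ : BinaryCode ι} (h : C₂ ≤ C₁)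
    {ρ : Matrix (ι → ZMod 2) (ι → ZMod 2) ℂ} (hρ : IsDensityMatrixOn (cssCode C₁ C₂) ρ) :
    codeProj C₁ C₂ * ρ = ρ :=
  Matrix.ext_of_mulVec_single fun i => by
    rw [← Matrix.mulVec_mulVec, codeProj_mulVec h (hρ.range _)]

lemma IsDensityMatrixOn.mul_codeProj {C₁ C₂ : BinaryCode ι} (h : C₂ ≤ C₁)
    {ρ : Matrix (ι → ZMod 2) (ι → ZMod 2) ℂ} (hρ : IsDensityMatrixOn (cssCode C₁ C₂) ρ) :
    ρ * codeProj C₁ C₂ = ρ := by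
  have := congrArg Matrix.conjTranspose (hρ.codeProj_mul h)
  rwa [Matrix.conjTranspose_mul, conjTranspose_codeProj h, hρ.posSemidef.isHermitian.eq] at this

/-- The Kraus operator of the partial trace over `S` that projects the erased qubits to the basis
state `w`. -/
def erasureKraus {ι : Type*} [Fintype ι] [DecidableEq ι] (S : Finset ι) (w : {i // i ∈ S} → ZMod 2) :
    Matrix ({i // i ∉ S} → ZMod 2) (ι → ZMod 2) ℂ :=
  (1 : Matrix (ι → ZMod 2) (ι → ZMod 2) ℂ).submatrix (glue S w) id

lemma erasureKraus_mul {S : Finset ι} (w : {i // i ∈ S} → ZMod 2)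
    (M : Matrix (ι → ZMod 2) (ι → ZMod 2) ℂ) :
    erasureKraus S w * M = M.submatrix (glue S w) id := by
  ext u y
  simp [erasureKraus, Matrix.mul_apply, Matrix.one_apply]

lemma mul_conjTranspose_erasureKraus {S : Finset ι} {m : Type*} (w : {i // i ∈ S} → ZMod 2)
    (M : Matrix m (ι → ZMod 2) ℂ) :
    M * (erasureKraus S w).conjTranspose = M.submatrix id (glue S w) := by
  ext u y
  simp [erasureKraus, Matrix.mul_apply, Matrix.one_apply]

lemma partialTrace_eq_sum (S : Finset ι) (ρ : Matrix (ι → ZMod 2) (ι → ZMod 2) ℂ) :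
    partialTrace S ρ = ∑ w, erasureKraus S w * ρ * (erasureKraus S w).conjTranspose := by
  ext u v
  rw [Matrix.sum_apply]
  exact Finset.sum_congr rfl fun w _ => by
    rw [mul_conjTranspose_erasureKraus, erasureKraus_mul]; rfl

/-- If every word of the dual of `C₂` supported in `S` lies in the dual of `C₁`, then every word
of `C₁` agrees on `S` with a word of `C₂`. -/
lemma exists_mem_eq_on {C₁ C₂ : BinaryCode ι} {S : Finset ι}
    (h : ∀ v ∈ dual C₂, (∀ i ∉ S, v i = 0) → v ∈ dual C₁) {y : ι → ZMod 2} (hy : y ∈ C₁) :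
    ∃ c ∈ C₂, ∀ i ∈ S, y i = c i := by
  let N : BinaryCode ι := LinearMap.ker
    (LinearMap.funLeft (ZMod 2) (ZMod 2) (Subtype.val : {i // i ∈ S} → ι))
  have hN : ∀ {v}, v ∈ N ↔ ∀ i ∈ S, v i = 0 := fun {v} =>
    ⟨fun hv i hi => congrFun hv ⟨i, hi⟩, fun hv => funext fun i => hv i i.2⟩
  by_cases hmem : y ∈ C₂ ⊔ N
  · obtain ⟨c, hc, z, hz, rfl⟩ := Submodule.mem_sup.1 hmem
    exact ⟨c, hc, fun i hi => by simp [hN.1 hz i hi]⟩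
  · obtain ⟨v, hv, hyv⟩ := exists_mem_dual_of_notMem hmem
    refine absurd (h v (fun x hx => hv x (Submodule.mem_sup_left hx)) (fun i hi => ?_) y hy) hyv
    have hsingle : (Pi.single i 1 : ι → ZMod 2) ∈ N :=
      hN.2 fun j hj => Pi.single_eq_of_ne (by rintro rfl; exact hi hj) _
    simpa using hv _ (Submodule.mem_sup_right hsingle)

/-- The number of words of `C` that agree with `w` on `S`. -/
def fiberSize {ι : Type*} [Fintype ι] [DecidableEq ι] (C : BinaryCode ι) (S : Finset ι)
    (w : {i // i ∈ S} → ZMod 2) : ℝ :=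
  ∑ u, ind C (glue S w u)

lemma sum_fiberSize (C : BinaryCode ι) (S : Finset ι) : ∑ w, fiberSize C S w = size C :=
  sum_glue S (ind C)

lemma fiberSize_zero_pos (C : BinaryCode ι) (S : Finset ι) : 0 < fiberSize C S 0 :=
  Finset.sum_pos' (fun _ _ => ind_nonneg C _)
    ⟨0, Finset.mem_univ _, by rw [glue_zero, ind_of_mem C.zero_mem]; exact one_pos⟩

lemma sum_ind_sub_glue {C : BinaryCode ι} {S : Finset ι} {y c : ι → ZMod 2} (hc : c ∈ C)
    (hyc : ∀ i ∈ S, y i = c i) (w : {i // i ∈ S} → ZMod 2) :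
    ∑ u, ind C (y - glue S w u) = fiberSize C S w := by
  rw [fiberSize, ← (Equiv.subRight fun i : {i // i ∉ S} => (y - c) i).sum_comp fun u =>
    ind C (glue S w u)]
  refine Finset.sum_congr rfl fun u _ => ?_
  have h1 : y - c = glue S 0 fun i => (y - c) i := by
    conv_lhs => rw [← glue_restrict S (y - c)]
    congr 1
    funext i
    simp [hyc i i.2]
  have h2 : glue S w ((Equiv.subRight fun i : {i // i ∉ S} => (y - c) i) u) =
      glue S w u - (y - c) := by
    rw [h1, ← glue_sub, sub_zero, ← h1]; rfl
  rw [h2, ← ind_neg, ← ind_add_of_mem hc (-_)]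
  congr 1
  abel

lemma fiberSize_eq_of_mem {C : BinaryCode ι} {S : Finset ι} {w : {i // i ∈ S} → ZMod 2}
    {u : {i // i ∉ S} → ZMod 2} (h : glue S w u ∈ C) : fiberSize C S w = fiberSize C S 0 := by
  rw [fiberSize, fiberSize, ← (Equiv.subRight u).sum_comp (fun v => ind C (glue S 0 v))]
  refine Finset.sum_congr rfl fun v _ => ?_
  have h1 : glue S 0 (Equiv.subRight u v) = glue S w v - glue S w u := by
    rw [← glue_sub, sub_self]; rfl
  rw [h1, ← ind_add_of_mem h (_ - _), add_sub_cancel]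

lemma fiberSize_mul_self (C : BinaryCode ι) (S : Finset ι) (w : {i // i ∈ S} → ZMod 2) :
    fiberSize C S w * fiberSize C S w = fiberSize C S 0 * fiberSize C S w := by
  by_cases h : ∃ u, glue S w u ∈ C
  · obtain ⟨u, hu⟩ := h
    rw [fiberSize_eq_of_mem hu]
  · push Not at h
    have h0 : fiberSize C S w = 0 := Finset.sum_eq_zero fun u _ => ind_of_notMem (h u)
    rw [h0, mul_zero, mul_zero]

/-- A CSS code corrects the erasure of `S` if no word of `C₁ \ C₂` and no word of
`C₂^⊥ \ C₁^⊥` is supported in `S`. -/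
theorem correctsErasure_cssCode {C₁ C₂ : BinaryCode ι} (h : C₂ ≤ C₁) {S : Finset ι}
    (hX : ∀ v ∈ C₁, (∀ i ∉ S, v i = 0) → v ∈ C₂)
    (hZ : ∀ v ∈ dual C₂, (∀ i ∉ S, v i = 0) → v ∈ dual C₁) :
    CorrectsErasure (cssCode C₁ C₂) S := by
  set N := size C₂ with hN
  have hNpos : 0 < N := size_pos C₂
  -- The number of words of `C₂` supported in `S`.
  set K : ℝ := ∑ w, ind C₂ (glue S w 0) with hK
  have hKpos : 0 < K := Finset.sum_pos' (fun _ _ => ind_nonneg C₂ _)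
    ⟨0, Finset.mem_univ _, by rw [glue_zero, ind_of_mem C₂.zero_mem]; exact one_pos⟩
  have hKright : ∀ w, ∑ w', ind C₂ (glue S (w - w') 0) = K := fun w =>
    (Equiv.subLeft w).sum_comp fun w => ind C₂ (glue S w 0)
  have hKleft : ∀ w', ∑ w, ind C₂ (glue S (w - w') 0) = K := fun w' =>
    (Equiv.subRight w').sum_comp fun w => ind C₂ (glue S w 0)
  have hdiff : ∀ w w' u, glue S w u = glue S (w - w') 0 + glue S w' u := fun w w' u => by
    rw [← sub_eq_iff_eq_add, ← glue_sub, sub_self]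
  let c : ({i // i ∈ S} → ZMod 2) → ({i // i ∈ S} → ZMod 2) → ℝ := fun w w' =>
    N⁻¹ * fiberSize C₂ S w * ind C₂ (glue S (w - w') 0)
  have hsq : ∀ y, ind C₂ y * ind C₂ y = ind C₂ y := fun y => by
    unfold ind; split_ifs <;> norm_num
  have hV : (erasureKraus S 0).conjTranspose.conjTranspose * (erasureKraus S 0).conjTranspose =
      1 := by
    rw [Matrix.conjTranspose_conjTranspose, mul_conjTranspose_erasureKraus]
    ext u v
    have hinj : glue S 0 u = glue S 0 v ↔ u = v := by
      simp [glue]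
    simp [erasureKraus, Matrix.one_apply, hinj]
  have hKL : ∀ w w', codeProj C₁ C₂ * (erasureKraus S w).conjTranspose *
      (erasureKraus S w' * codeProj C₁ C₂) = (c w w' : ℂ) • codeProj C₁ C₂ := by
    -- For `y, z ∈ C₁` the entry counts, up to a scalar, the `u` with `glue S w u ∈ y + C₂` and
    -- `glue S w' u ∈ z + C₂`. Such a `u` exists only if `glue S (w - w') 0` lies in `C₁`, hence
    -- in `C₂`; then `y - z ∈ C₂`, the two conditions on `u` agree, and the count is that for
    -- `y = 0`.
    intro w w'
    rw [mul_conjTranspose_erasureKraus, erasureKraus_mul]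
    ext y z
    simp only [Matrix.mul_apply, Matrix.submatrix_apply, id, Matrix.smul_apply, smul_eq_mul,
      codeProj, ← Complex.ofReal_mul, ← Complex.ofReal_sum]
    congr 1
    by_cases hy : y ∈ C₁
    swap
    · rw [ind_of_notMem hy]; simp
    obtain ⟨x, hx, hyx⟩ := exists_mem_eq_on hZ hy
    have hterm : ∀ u, N⁻¹ * (ind C₁ y * ind C₂ (y - glue S w u)) *
        (N⁻¹ * (ind C₁ (glue S w' u) * ind C₂ (glue S w' u - z))) =
        N⁻¹ * N⁻¹ * ind C₂ (glue S (w - w') 0) * ind C₁ y * ind C₂ (y - z) *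
          ind C₂ (y - glue S w u) := by
      intro u
      by_cases hyu : y - glue S w u ∈ C₂
      swap
      · rw [ind_of_notMem hyu]; ring
      have hwu : glue S w u ∈ C₁ := by simpa using C₁.sub_mem hy (h hyu)
      by_cases hd : glue S (w - w') 0 ∈ C₂
      · have hw'u : glue S w' u ∈ C₁ := by
          have := C₁.sub_mem hwu (h hd)
          rwa [hdiff w w' u, add_sub_cancel_left] at this
        have hyu' : y - glue S w' u ∈ C₂ := by
          have := C₂.add_mem hyu hd
          rwa [hdiff w w' u, sub_add_eq_sub_sub_swap, sub_add_cancel] at this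
        have h2 := ind_sub_mul_ind_sub C₂ y (glue S w' u) z
        rw [ind_of_mem hyu', one_mul, one_mul] at h2
        rw [ind_of_mem hw'u, ind_of_mem hd, h2]
        ring
      · rw [ind_of_notMem hd]
        rw [ind_of_notMem (C := C₁) (y := glue S w' u)]
        · ring
        · intro hw'u
          refine hd (hX _ ?_ fun i hi => glue_apply_notMem _ _ hi)
          have := C₁.sub_mem hwu hw'u
          rwa [hdiff w w' u, add_sub_cancel_right] at this
    rw [Finset.sum_congr rfl fun u _ => hterm u, ← Finset.mul_sum, sum_ind_sub_glue hx hyx]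
    ring
  have hfix : ∀ w', ∑ w, (c w w' : ℂ) • (erasureKraus S w * codeProj C₁ C₂) =
      ((N⁻¹ * fiberSize C₂ S 0 * K : ℝ) : ℂ) • (erasureKraus S w' * codeProj C₁ C₂) := by
    intro w'
    simp_rw [erasureKraus_mul]
    ext u z
    simp only [Matrix.sum_apply, Matrix.submatrix_apply, id, Matrix.smul_apply, smul_eq_mul,
      codeProj, ← Complex.ofReal_mul, ← Complex.ofReal_sum]
    congr 1
    by_cases hw'u : glue S w' u ∈ C₁
    · obtain ⟨x, hx, hux⟩ := exists_mem_eq_on hZ hw'u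
      have hx' : glue S w' (fun i => x i) ∈ C₂ := by
        rw [← glue_restrict S x] at hx
        convert hx using 2
        funext i
        rw [← hux i i.2, glue_apply_mem _ _ i.2]
      have hterm : ∀ w, c w w' *
          ((size C₂)⁻¹ * (ind C₁ (glue S w u) * ind C₂ (glue S w u - z))) =
          N⁻¹ * fiberSize C₂ S 0 * ((size C₂)⁻¹ * (ind C₁ (glue S w' u) *
            ind C₂ (glue S w' u - z))) * ind C₂ (glue S (w - w') 0) := by
        intro w
        by_cases hd : glue S (w - w') 0 ∈ C₂
        · have hfw : fiberSize C₂ S w = fiberSize C₂ S 0 := by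
            refine fiberSize_eq_of_mem (u := fun i => x i) ?_
            rw [hdiff w w']
            exact C₂.add_mem hd hx'
          rw [hdiff w w' u, add_sub_assoc, ind_add_of_mem hd, ind_add_of_mem (h hd)]
          simp only [c]
          rw [hfw]
          ring
        · simp only [c]
          rw [ind_of_notMem hd]; ring
      rw [Finset.sum_congr rfl fun w _ => hterm w, ← Finset.mul_sum, hKleft]
      ring
    · rw [ind_of_notMem hw'u, zero_mul, mul_zero, mul_zero]
      refine Finset.sum_eq_zero fun w _ => ?_
      by_cases hd : glue S (w - w') 0 ∈ C₂
      · rw [hdiff w w' u, ind_add_of_mem (h hd), ind_of_notMem hw'u]; ring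
      · simp only [c]
        rw [ind_of_notMem hd]; ring
  have hc : ∑ w, ∑ w', c w w' * c w w' = N⁻¹ * fiberSize C₂ S 0 * K := by
    have hterm : ∀ w w', c w w' * c w w' =
        N⁻¹ * N⁻¹ * fiberSize C₂ S 0 * fiberSize C₂ S w * ind C₂ (glue S (w - w') 0) := by
      intro w w'
      simp only [c]
      linear_combination N⁻¹ * N⁻¹ * ind C₂ (glue S (w - w') 0) * fiberSize_mul_self C₂ S w +
        N⁻¹ * N⁻¹ * fiberSize C₂ S w * fiberSize C₂ S w * hsq (glue S (w - w') 0)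
    simp_rw [hterm, ← Finset.mul_sum, hKright, ← Finset.sum_mul, ← Finset.mul_sum]
    rw [sum_fiberSize, ← hN]
    field_simp
  have hκ : 0 < N⁻¹ * fiberSize C₂ S 0 * K := by
    have := fiberSize_zero_pos C₂ S
    positivity
  obtain ⟨R, hR1, hR2⟩ := exists_recovery (conjTranspose_codeProj h) (codeProj_mul_self h) hV hκ
    hKL hfix hc
  let e := Fintype.equivFin (Option ({i // i ∈ S} → ZMod 2))
  refine ⟨_, fun k => R (e.symm k), ?_, fun ρ hρ => ?_⟩
  · rw [e.symm.sum_comp fun k => (R k).conjTranspose * R k, hR1]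
  · rw [e.symm.sum_comp fun k => R k * partialTrace S ρ * (R k).conjTranspose,
      partialTrace_eq_sum]
    exact hR2 ρ (hρ.codeProj_mul h) (hρ.mul_codeProj h)

/-- A CSS code corrects every erasure of fewer qubits than its CSS distance. -/
theorem hasParameters_cssCode {C₁ C₂ : BinaryCode ι} (h : C₂ ≤ C₁) {d : ℕ}
    (hd : (d : ℕ∞) ≤ cssDistance C₁ C₂) :
    HasParameters (cssCode C₁ C₂)
      (Module.finrank (ZMod 2) C₁ - Module.finrank (ZMod 2) C₂) d := by
  refine ⟨finrank_cssCode h, fun S hS => ?_⟩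
  have hwt : ∀ v : ι → ZMod 2, (∀ i ∉ S, v i = 0) → hammingNorm v < d := fun v hv =>
    (Finset.card_le_card fun i hi => by
      by_contra hiS
      exact (Finset.mem_filter.1 hi).2 (hv i hiS)).trans_lt hS
  have hdist : ∀ v ∈ ((C₁ : Set (ι → ZMod 2)) \ C₂) ∪ ((dual C₂ : Set (ι → ZMod 2)) \ dual C₁),
      d ≤ hammingNorm v := fun v hv => by
    exact_mod_cast hd.trans (iInf₂_le v hv)
  refine correctsErasure_cssCode h (fun v hv hvS => ?_) fun v hv hvS => ?_
  · by_contra hcon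
    exact (hwt v hvS).not_ge (hdist v (Or.inl ⟨hv, hcon⟩))
  · by_contra hcon
    exact (hwt v hvS).not_ge (hdist v (Or.inr ⟨hv, hcon⟩))

end Erasure

end CSST

end

theorem theorem4p9 {F : Type*} [Field F] [Algebra (ZMod 2) F] (s n : ℕ) [NeZero n]
    (hs : 1 < s) (hF : Nat.card F = 2 ^ s) (hn : n ∣ 2 ^ s - 1)
    (β : F) (hβ : IsPrimitiveRoot β n)
    (I₁ I₂ : Finset (ZMod n))
    (hI₁ : CSST.IsCyclotomicCoset I₁) (hI₂ : CSST.IsCyclotomicCoset I₂) :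
    (CSST.IsCSSTPair (CSST.cyclicCode β I₁) (CSST.cyclicCode β I₂) ↔
      I₂ ⊆ I₁ ∧ ((n : ℕ) : ZMod n) ∉ I₁ + I₁ + I₂) ∧
    (CSST.IsCSSTPair (CSST.cyclicCode β I₁) (CSST.cyclicCode β I₂) →
      CSST.HasParameters (CSST.cssCode (CSST.cyclicCode β I₁) (CSST.cyclicCode β I₂))
        (I₁.card - I₂.card) (n - CSST.amplitude I₂ᶜ + 1) ∧
      ((n - CSST.amplitude I₂ᶜ + 1 : ℕ) : ℕ∞) ≤
        CSST.cssDistance (CSST.cyclicCode β I₁) (CSST.cyclicCode β I₂)) := by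
  have : Finite F := Nat.finite_of_card_ne_zero (hF ▸ pow_ne_zero s two_ne_zero)
  have hn1 : (n : F) = 1 :=
    CSST.natCast_eq_one_of_odd (CSST.odd_of_dvd_two_pow_sub_one (by omega) hn)
  have hiff : CSST.IsCSSTPair (CSST.cyclicCode β I₁) (CSST.cyclicCode β I₂) ↔
      I₂ ⊆ I₁ ∧ ((n : ℕ) : ZMod n) ∉ I₁ + I₁ + I₂ := by
    rw [CSST.isCSSTPair_iff, CSST.cyclicCode_le_iff hβ hn1 hI₂,
      CSST.triple_product_eq_zero_iff hβ hn1 hI₁ hI₂, ZMod.natCast_self]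
  refine ⟨hiff, fun h => ?_⟩
  have hsum := (hiff.1 h).2
  rw [ZMod.natCast_self] at hsum
  have hd := CSST.le_cssDistance_cyclicCode hβ hn1 hI₂ hsum
  refine ⟨?_, hd⟩
  have hpar := CSST.hasParameters_cssCode h.le hd
  rwa [CSST.finrank_cyclicCode hβ hn1 hI₁, CSST.finrank_cyclicCode hβ hn1 hI₂] at hpar
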